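/- **Theorem 5.3.** Let $G_2$ be a finite simple connected $k$-regular graph on $n_2$ vertices with $k\equiv 0\pmod 4$, and suppose that neither $\sqrt{(2+k)^2+16n_2}$ nor $\sqrt{(2-k)^2+16n_2}$ is an integer. Let $C_4$ be the cycle on four vertices, and let $C_4\bigstar G_2$ be the neighborhood corona, i.e. the graph with vertex set $V(C_4)\times(\{0\}\cup V(G_2))$ (where $0\notin V(G_2)$) in which $(x,y)$ and $(x',y')$ are adjacent if and only if one of the following holds: (a) $y=y'=0$ and $xx'\in E(C_4)$; (b) $x=x'$, $y,y'\in V(G_2)$ and $yy'\in E(G_2)$; (c) $xx'\in E(C_4)$ and exactly one of $y,y'$ is $0$. Let $A$ be the adjacency matrix of $C_4\bigstar G_2$. Then for any two antipodal vertices $v_1,v_3$ of $C_4$ (vertices at distance $2$), $C_4\bigstar G_2$ has pretty good state transfer between $(v_1,0)$ and $(v_3,0)$: for every $\epsilon>0$ there is a time $\tau>0$ such that $$\left|e_{(v_3,0)}^{T}\exp(-i\tau A)\,e_{(v_1,0)}\right|>1-\epsilon ,$$ where $e_w$ denotes the standard basis vector of the vertex $w$. -/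

import Mathlib

namespace SimpleGraph

/-- The neighborhood corona of `G₁` and `G₂`, on the vertex set `V₁ × ({0} ∪ V₂)`, where
`none : Option V₂` plays the role of `0`. The pairs `(x, none)` form the copy of `G₁`, the pairs
`(x, some y)` with `x` fixed form the copy of `G₂` attached to `x`, and every neighbor of `x` in
`G₁` is joined to all vertices of that copy. -/
def neighborhoodCorona {V₁ V₂ : Type*} (G₁ : SimpleGraph V₁) (G₂ : SimpleGraph V₂) :
    SimpleGraph (V₁ × Option V₂) where
  Adj p q :=
    match p, q with
    | (x, none), (x', none) => G₁.Adj x x'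
    | (x, some y), (x', some y') => x = x' ∧ G₂.Adj y y'
    | (x, none), (x', some _) => G₁.Adj x x'
    | (x, some _), (x', none) => G₁.Adj x x'
  symm := ⟨by
    rintro ⟨x, _ | y⟩ ⟨x', _ | y'⟩ h
    · exact G₁.adj_symm h
    · exact G₁.adj_symm h
    · exact G₁.adj_symm h
    · exact ⟨h.1.symm, G₂.adj_symm h.2⟩⟩
  loopless := ⟨by
    rintro ⟨x, _ | y⟩ h
    · exact G₁.irrefl h
    · exact G₂.irrefl h.2⟩

open Classical in
/-- The transition matrix `exp (-i t A(G))` of the continuous-time quantum walk on a finite graph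
`G`, where `A(G)` is the adjacency matrix. -/
noncomputable def transitionMatrix {V : Type*} [Fintype V] (G : SimpleGraph V) (t : ℝ) :
    Matrix V V ℂ :=
  NormedSpace.exp ((-(Complex.I * (t : ℂ))) • G.adjMatrix ℂ)

/-- Pretty good state transfer (relative to the adjacency matrix) between the vertices `x` and
`y`: for every `ε > 0` there is a time `τ > 0` with `|e_yᵀ exp (-i τ A(G)) e_x| > 1 - ε`. -/
def PrettyGoodStateTransfer {V : Type*} [Fintype V] (G : SimpleGraph V) (x y : V) : Prop :=
  ∀ ε : ℝ, 0 < ε → ∃ τ : ℝ, 0 < τ ∧ 1 - ε < ‖G.transitionMatrix τ y x‖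

end SimpleGraph

section

open Filter Topology Finset

section MatrixExponential

attribute [local instance] Matrix.linftyOpNormedRing Matrix.linftyOpNormedAlgebra

/-! An eigenvector of `C₄` for `lam` = 2, -2 or 0 lifts to eigenvectors of the corona. For `lam =
±2` the eigenvalues are `(lam + k ± s) / 2` with `s ^ 2 = (lam - k) ^ 2 + 16 n₂`; as 4 divides `k`,
the half-sum `(lam + k) / 2` is odd and contributes the phase -1 at every time `π (4 l + 1)`. It
remains to choose `l` making all the phases from the irrational `± s / 2` nearly 1
(`exists_norm_exp_sub_one_lt`). Then the `±2` components of the initial state are nearly negated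
while the kernel component is fixed, and at the antipode all three add up to nearly -1.

Such an `l` comes from high moments of an exponential sum, replacing Kronecker's theorem, so the two
square roots need not be independent over the rationals. -/

theorem Matrix.exp_smul_mulVec_of_mulVec_eq_smul {n : Type*} [Fintype n] [DecidableEq n]
    (M : Matrix n n ℂ) (v : n → ℂ) (μ c : ℂ) (h : M.mulVec v = μ • v) :
    (NormedSpace.exp (c • M)).mulVec v = Complex.exp (c * μ) • v := by
  have hpow : ∀ m : ℕ, ((c • M) ^ m).mulVec v = (c * μ) ^ m • v := by
    intro m
    induction m with
    | zero => simp
    | succ m ih =>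
      rw [pow_succ, ← Matrix.mulVec_mulVec, Matrix.smul_mulVec, h, smul_smul,
        Matrix.mulVec_smul, ih, smul_smul, pow_succ, mul_comm]
  have h1 := NormedSpace.exp_series_hasSum_exp' (𝕂 := ℂ) (c • M)
  let F : Matrix n n ℂ →+ (n → ℂ) :=
    { toFun := fun A => A.mulVec v
      map_zero' := Matrix.zero_mulVec v
      map_add' := fun A B => Matrix.add_mulVec A B v }
  have hF : Continuous F := by
    change Continuous fun A : Matrix n n ℂ => A.mulVec v
    fun_prop
  have h2 := h1.map F hF
  have h3 := (NormedSpace.exp_series_hasSum_exp' (𝕂 := ℂ) (c * μ)).smul_const v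
  rw [← Complex.exp_eq_exp_ℂ] at h3
  refine h2.unique ?_
  convert h3 using 2 with m
  change (((m.factorial : ℂ)⁻¹) • (c • M) ^ m).mulVec v = _
  rw [Matrix.smul_mulVec, hpow, smul_smul, smul_eq_mul]

end MatrixExponential

/-! ### Averages of exponentials over the admissible times -/

/-- The averages of the powers of a complex number of modulus at most one, other than one, tend
to zero. -/
theorem tendsto_average_pow_of_ne_one {z : ℂ} (hz : ‖z‖ ≤ 1) (hz1 : z ≠ 1) :
    Tendsto (fun L : ℕ => (∑ l ∈ range L, z ^ l) / (L : ℂ)) atTop (𝓝 0) := by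
  rw [tendsto_zero_iff_norm_tendsto_zero]
  have hb : Tendsto (fun L : ℕ => (2 / ‖z - 1‖) / (L : ℝ)) atTop (𝓝 0) :=
    tendsto_const_div_atTop_nhds_zero_nat _
  refine squeeze_zero (fun _ => norm_nonneg _) (fun L => ?_) hb
  rw [norm_div, Complex.norm_natCast, geom_sum_eq hz1, norm_div]
  gcongr
  calc ‖z ^ L - 1‖ ≤ ‖z ^ L‖ + ‖(1 : ℂ)‖ := norm_sub_le _ _
    _ ≤ 1 + 1 := by
      rw [norm_pow, norm_one]
      gcongr
      exact pow_le_one₀ (norm_nonneg _) hz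
    _ = 2 := by norm_num

theorem tendsto_average_one :
    Tendsto (fun L : ℕ => (∑ _l ∈ range L, (1 : ℂ)) / (L : ℂ)) atTop (𝓝 1) := by
  refine tendsto_const_nhds.congr' ?_
  filter_upwards [eventually_gt_atTop 0] with L hL
  have : (L : ℂ) ≠ 0 := by exact_mod_cast hL.ne'
  simp [this]

/-- The terms form a geometric progression of ratio `exp (2πiφ)`, which is not 1 for irrational `φ`.
-/
theorem tendsto_average_exp_quarter (φ : ℝ) (hφ : φ = 0 ∨ Irrational φ) :
    Tendsto (fun L : ℕ => (∑ l ∈ range L,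
      Complex.exp (Complex.I * (Real.pi / 2 * (4 * l + 1)) * φ)) / (L : ℂ)) atTop
      (𝓝 (if φ = 0 then 1 else 0)) := by
  rcases hφ with rfl | hφ
  · simpa using tendsto_average_one
  · rw [if_neg hφ.ne_zero]
    set z := Complex.exp (2 * Real.pi * Complex.I * φ) with hz
    have hz1 : z ≠ 1 := by
      intro h
      obtain ⟨n, hn⟩ := Complex.exp_eq_one_iff.1 h
      have h2 : (φ : ℂ) = n := by
        have : (2 * Real.pi * Complex.I : ℂ) ≠ 0 := Complex.two_pi_I_ne_zero
        apply mul_left_cancel₀ this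
        rw [hn]; ring
      exact hφ.ne_int n (by exact_mod_cast h2)
    have hn : ‖z‖ ≤ 1 := by
      have : (2 * Real.pi * Complex.I * φ : ℂ) = ((2 * Real.pi * φ : ℝ) : ℂ) * Complex.I := by
        push_cast; ring
      rw [hz, this, Complex.norm_exp_ofReal_mul_I]
    have := (tendsto_average_pow_of_ne_one hn hz1).const_mul
      (Complex.exp (Complex.I * (Real.pi / 2) * φ))
    rw [mul_zero] at this
    refine this.congr fun L => ?_
    rw [← mul_div_assoc, Finset.mul_sum]
    congr 1
    refine Finset.sum_congr rfl fun l _ => ?_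
    rw [hz, ← Complex.exp_nat_mul, ← Complex.exp_add]
    congr 1
    ring

/-! ### Simultaneous approximation by the moment method -/

section SimultaneousApproximation

variable {J : Type*} [Fintype J] (φ : J → ℝ)

/-- The number of pairs of `M`-tuples of indices at which `φ` has the same sum. -/
noncomputable def additiveEnergyCount (M : ℕ) : ℕ :=
  #{p : (Fin M → J) × (Fin M → J) | ∑ i, φ (p.1 i) = ∑ i, φ (p.2 i)}

/-- Tuples with equal multiplicities have equal sums, and there are at most `(M + 1) ^ card J`
multiplicity vectors; apply Cauchy–Schwarz to the class sizes. -/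
theorem card_pow_le_mul_additiveEnergyCount (M : ℕ) :
    Fintype.card J ^ (2 * M) ≤ (M + 1) ^ Fintype.card J * additiveEnergyCount φ M := by
  classical
  let cnt : (Fin M → J) → (J → Fin (M + 1)) := fun f j =>
    ⟨#{i | f i = j}, Nat.lt_succ_of_le ((card_le_univ _).trans_eq (Fintype.card_fin M))⟩
  have hsum : ∀ f : Fin M → J, ∑ i, φ (f i) = ∑ j, ((cnt f j : ℕ) : ℝ) * φ j := by
    intro f
    rw [← Finset.sum_fiberwise (s := univ) (g := f)]
    refine Finset.sum_congr rfl fun j _ => ?_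
    rw [Finset.sum_congr rfl (g := fun _ => φ j), Finset.sum_const, nsmul_eq_mul]
    intro i hi
    rw [(Finset.mem_filter.1 hi).2]
  have h1 : #{p : (Fin M → J) × (Fin M → J) | cnt p.1 = cnt p.2} ≤ additiveEnergyCount φ M := by
    refine card_le_card fun p hp => ?_
    rw [mem_filter] at hp ⊢
    exact ⟨mem_univ _, by rw [hsum, hsum, hp.2]⟩
  have h2 : #{p : (Fin M → J) × (Fin M → J) | cnt p.1 = cnt p.2}
      = ∑ v : J → Fin (M + 1), (#{f | cnt f = v}) ^ 2 := by
    rw [card_eq_sum_card_fiberwise (f := fun p => cnt p.1) (t := univ)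
      (fun _ _ => mem_coe.2 (mem_univ _))]
    refine Finset.sum_congr rfl fun v _ => ?_
    rw [sq, ← card_product]
    congr 1
    ext p
    simp only [mem_filter, mem_univ, true_and, mem_product]
    constructor
    · rintro ⟨h, h'⟩; exact ⟨h', h ▸ h'⟩
    · rintro ⟨h, h'⟩; exact ⟨h.trans h'.symm, h⟩
  have h3 : ∑ v : J → Fin (M + 1), #{f | cnt f = v} = Fintype.card J ^ M := by
    rw [← card_eq_sum_card_fiberwise (f := cnt) (s := univ) (t := univ)
      (fun _ _ => mem_coe.2 (mem_univ _))]
    simp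
  have h4 := sq_sum_le_card_mul_sum_sq (s := (univ : Finset (J → Fin (M + 1))))
    (f := fun v => #{f | cnt f = v})
  rw [h3, ← h2] at h4
  calc Fintype.card J ^ (2 * M) = (Fintype.card J ^ M) ^ 2 := by rw [← pow_mul, mul_comm]
    _ ≤ _ := h4
    _ ≤ _ := by
      gcongr
      · simp

theorem norm_sum_exp_pow_eq (t : ℝ) (M : ℕ) :
    ((‖∑ j, Complex.exp (Complex.I * t * φ j)‖ ^ (2 * M) : ℝ) : ℂ) =
      ∑ p : (Fin M → J) × (Fin M → J),
        Complex.exp (Complex.I * t * ((∑ i, φ (p.1 i) - ∑ i, φ (p.2 i) : ℝ) : ℂ)) := by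
  classical
  rw [pow_mul]
  push_cast
  rw [← Complex.mul_conj', mul_pow, map_sum, Fintype.sum_pow, Fintype.sum_pow,
    Finset.sum_mul_sum, Fintype.sum_prod_type]
  refine Finset.sum_congr rfl fun f _ => ?_
  refine Finset.sum_congr rfl fun g _ => ?_
  simp only [← Complex.exp_conj, map_mul, Complex.conj_I, Complex.conj_ofReal]
  rw [← Complex.exp_sum, ← Complex.exp_sum, ← Complex.exp_add, ← Finset.mul_sum, ← Finset.mul_sum]
  congr 1
  ring

/-- After expansion into pairs of tuples, only those of zero frequency difference survive averaging.
-/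
theorem tendsto_average_norm_sum_exp_pow
    (hφ : ∀ c : J → ℤ, ∑ j, (c j : ℝ) * φ j = 0 ∨ Irrational (∑ j, (c j : ℝ) * φ j)) (M : ℕ) :
    Tendsto (fun L : ℕ => (∑ l ∈ range L,
      ‖∑ j, Complex.exp (Complex.I * ((Real.pi / 2 * (4 * l + 1) : ℝ) : ℂ) * φ j)‖ ^ (2 * M))
        / (L : ℝ)) atTop (𝓝 (additiveEnergyCount φ M)) := by
  classical
  have hd : ∀ p : (Fin M → J) × (Fin M → J), (∑ i, φ (p.1 i) - ∑ i, φ (p.2 i) = 0) ∨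
      Irrational (∑ i, φ (p.1 i) - ∑ i, φ (p.2 i)) := by
    intro p
    have hsum : ∀ f : Fin M → J, ∑ i, φ (f i) = ∑ j, ((#{i | f i = j} : ℤ) : ℝ) * φ j := by
      intro f
      rw [← Finset.sum_fiberwise (s := univ) (g := f)]
      refine Finset.sum_congr rfl fun j _ => ?_
      rw [Finset.sum_congr rfl (g := fun _ => φ j), Finset.sum_const, nsmul_eq_mul]
      · simp
      · intro i hi
        rw [(Finset.mem_filter.1 hi).2]
    have := hφ fun j => (#{i | p.1 i = j} : ℤ) - (#{i | p.2 i = j} : ℤ)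
    rw [hsum, hsum, ← Finset.sum_sub_distrib]
    simpa only [Int.cast_sub, sub_mul] using this
  have h1 := tendsto_finsetSum (univ : Finset ((Fin M → J) × (Fin M → J)))
    fun p _ => tendsto_average_exp_quarter _ (hd p)
  have h2 : (∑ p : (Fin M → J) × (Fin M → J),
      if ∑ i, φ (p.1 i) - ∑ i, φ (p.2 i) = 0 then (1 : ℂ) else 0)
      = ((additiveEnergyCount φ M : ℝ) : ℂ) := by
    rw [Finset.sum_boole, additiveEnergyCount]
    simp only [sub_eq_zero]
    push_cast
    congr!
  rw [h2] at h1
  rw [← tendsto_ofReal_iff]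
  refine h1.congr fun L => ?_
  rw [Complex.ofReal_div, Complex.ofReal_sum, Complex.ofReal_natCast, ← Finset.sum_div,
    Finset.sum_comm]
  congr 1
  refine Finset.sum_congr rfl fun l _ => ?_
  rw [norm_sum_exp_pow_eq]
  push_cast
  rfl

/-- A uniform bound `r < card J` would make the moments exponentially smaller than `card J ^ (2 *
M)`, but they lose only a polynomial factor. -/
theorem exists_lt_norm_sum_exp [Nonempty J]
    (hφ : ∀ c : J → ℤ, ∑ j, (c j : ℝ) * φ j = 0 ∨ Irrational (∑ j, (c j : ℝ) * φ j))
    {r : ℝ} (hr0 : 0 ≤ r) (hr : r < Fintype.card J) :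
    ∃ l : ℕ, r < ‖∑ j, Complex.exp (Complex.I * ((Real.pi / 2 * (4 * l + 1) : ℝ) : ℂ) * φ j)‖ := by
  by_contra! hcon
  have hn : (0 : ℝ) < Fintype.card J := by exact_mod_cast Fintype.card_pos
  have hle : ∀ M : ℕ, (additiveEnergyCount φ M : ℝ) ≤ r ^ (2 * M) := by
    intro M
    refine le_of_tendsto (tendsto_average_norm_sum_exp_pow φ hφ M) ?_
    filter_upwards [eventually_gt_atTop 0] with L hL
    have hL' : (0 : ℝ) < L := by exact_mod_cast hL
    rw [div_le_iff₀ hL']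
    calc _ ≤ ∑ _l ∈ range L, r ^ (2 * M) :=
          Finset.sum_le_sum fun l _ => pow_le_pow_left₀ (norm_nonneg _) (hcon l) _
      _ = r ^ (2 * M) * L := by simp [mul_comm]
  set q := (r / Fintype.card J) ^ 2 with hq
  have hq0 : 0 ≤ q := sq_nonneg _
  have hq1 : q < 1 := by
    rw [hq, sq_lt_one_iff₀ (by positivity), div_lt_one hn]
    exact hr
  have hge : ∀ M : ℕ, 1 ≤ ((M : ℝ) + 1) ^ Fintype.card J * q ^ M := by
    intro M
    have h : (Fintype.card J : ℝ) ^ (2 * M) ≤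
        ((M : ℝ) + 1) ^ Fintype.card J * additiveEnergyCount φ M := by
      exact_mod_cast card_pow_le_mul_additiveEnergyCount φ M
    rw [hq, ← pow_mul, div_pow, ← mul_div_assoc, le_div_iff₀ (by positivity), one_mul]
    exact h.trans (by gcongr; exact hle M)
  have hlim : Tendsto (fun M : ℕ => ((M : ℝ) + 1) ^ Fintype.card J * q ^ M) atTop (𝓝 0) := by
    rcases hq0.eq_or_lt with h0 | h0
    · refine tendsto_const_nhds.congr' ?_
      filter_upwards [eventually_gt_atTop 0] with M hM
      rw [← h0, zero_pow hM.ne', mul_zero]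
    · have h := ((tendsto_pow_const_mul_const_pow_of_lt_one (Fintype.card J) hq0 hq1).comp
        (tendsto_add_atTop_nat 1)).const_mul q⁻¹
      rw [mul_zero] at h
      refine h.congr fun M => ?_
      simp only [Function.comp_apply]
      push_cast
      rw [pow_succ]
      field_simp
  obtain ⟨M, hM⟩ := (hlim.eventually (gt_mem_nhds one_pos)).exists
  exact absurd (hge M) (not_le.2 hM)

/-- If the integer combinations of finitely many real numbers `φ j` are zero or irrational, then
some `4 * l + 1` makes all `(4 * l + 1) * φ j / 4` close to integers. -/
theorem exists_norm_exp_sub_one_lt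
    (hφ : ∀ c : J → ℤ, ∑ j, (c j : ℝ) * φ j = 0 ∨ Irrational (∑ j, (c j : ℝ) * φ j))
    {ε : ℝ} (hε : 0 < ε) :
    ∃ l : ℕ, ∀ j,
      ‖Complex.exp (Complex.I * ((Real.pi / 2 * (4 * l + 1) : ℝ) : ℂ) * φ j) - 1‖ < ε := by
  classical
  -- The extra frequency 0 forces the phases to align with 1, not merely with each other.
  let ψ : Option J → ℝ := fun o => o.elim 0 φ
  have hψ : ∀ c : Option J → ℤ, ∑ j, (c j : ℝ) * ψ j = 0 ∨ Irrational (∑ j, (c j : ℝ) * ψ j) := by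
    intro c
    simpa [Fintype.sum_option, ψ] using hφ fun j => c (some j)
  -- By the parallelogram law, `‖z - 1‖ ^ 2 < 4 - (2 - η) ^ 2 ≤ 4 η ≤ ε ^ 2`.
  set η : ℝ := min 1 (ε ^ 2 / 4) with hη
  have hη0 : 0 < η := by positivity
  have hη1 : η ≤ 1 := min_le_left _ _
  have hη2 : η ≤ ε ^ 2 / 4 := min_le_right _ _
  have hcard : (Fintype.card (Option J) : ℝ) = Fintype.card J + 1 := by simp
  obtain ⟨l, hl⟩ := exists_lt_norm_sum_exp ψ hψ (r := Fintype.card (Option J) - η)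
    (by rw [hcard]; have : (0 : ℝ) ≤ Fintype.card J := Nat.cast_nonneg _; linarith)
    (by linarith)
  refine ⟨l, fun j => ?_⟩
  set t : ℝ := Real.pi / 2 * (4 * l + 1) with ht
  have hnorm : ∀ j, ‖Complex.exp (Complex.I * t * φ j)‖ = 1 := by
    intro j
    have : Complex.I * t * φ j = ((t * φ j : ℝ) : ℂ) * Complex.I := by push_cast; ring
    rw [this, Complex.norm_exp_ofReal_mul_I]
  set z := Complex.exp (Complex.I * t * φ j) with hz
  have hsplit : ‖∑ j, Complex.exp (Complex.I * t * ψ j)‖ ≤ ‖1 + z‖ + (Fintype.card J - 1) := by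
    rw [Fintype.sum_option, ← Finset.add_sum_erase _ _ (mem_univ j), ← add_assoc]
    simp only [ψ, Option.elim, Complex.ofReal_zero, mul_zero, Complex.exp_zero]
    refine (norm_add_le _ _).trans ?_
    gcongr
    refine (norm_sum_le _ _).trans ?_
    have hpos : 1 ≤ Fintype.card J := Fintype.card_pos_iff.2 ⟨j⟩
    simp [hnorm, card_erase_of_mem, Nat.cast_sub hpos]
  have h1 : 2 - η < ‖1 + z‖ := by rw [hcard] at hl; linarith
  have hpar := parallelogram_law_with_norm ℝ z 1
  rw [hz, hnorm j, ← hz, norm_one, add_comm z 1] at hpar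
  have h2 : (2 - η) ^ 2 < ‖1 + z‖ ^ 2 := by
    apply pow_lt_pow_left₀ h1 (by linarith) (by norm_num)
  refine lt_of_pow_lt_pow_left₀ 2 hε.le ?_
  nlinarith

end SimultaneousApproximation

theorem combination_eq_zero_or_irrational {s t : ℝ} (hs : Irrational s) (ht : Irrational t)
    {A B : ℤ} (hA : s ^ 2 = A) (hB : t ^ 2 = B) (a b : ℤ) :
    (a : ℝ) * s + b * t = 0 ∨ Irrational ((a : ℝ) * s + b * t) := by
  by_contra! h
  obtain ⟨h0, h1⟩ := h
  obtain ⟨q, hq⟩ := not_not.1 h1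
  replace hq := hq.symm
  by_cases ha : a = 0
  · subst ha
    have hb : b ≠ 0 := by rintro rfl; simp at h0
    refine h1 ?_
    simpa using ht.intCast_mul hb
  · have hq0 : q ≠ 0 := by rintro rfl; exact h0 (by rw [hq]; simp)
    have ha' : (a : ℝ) ≠ 0 := by exact_mod_cast ha
    have hq0' : (q : ℝ) ≠ 0 := by exact_mod_cast hq0
    -- Squaring `b t = q - a s` and solving for `s`.
    refine hs ⟨(q ^ 2 + a ^ 2 * A - b ^ 2 * B) / (2 * q * a), ?_⟩
    push_cast
    rw [← hA, ← hB, div_eq_iff (by positivity), ← hq]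
    ring

namespace SimpleGraph

/-! ### Eigenvectors of the neighborhood corona -/

section Corona

variable {V₁ V₂ : Type*}

/-- The function on the vertices of a neighborhood corona that is `a • u` on the copy of the first
graph and `b • u x` on the copy of the second graph attached to `x`. -/
def coronaVector (V₂ : Type*) (u : V₁ → ℂ) (a b : ℂ) : V₁ × Option V₂ → ℂ :=
  fun p => u p.1 * p.2.elim a fun _ => b

/-- The two lifted eigenvectors share `b = lam`, so their difference lives on the base copy. -/
theorem coronaVector_one_zero {s : ℂ} (hs : s ≠ 0) (u : V₁ → ℂ) (k lam : ℂ) :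
    coronaVector V₂ u 1 0 =
      s⁻¹ • (coronaVector V₂ u ((lam + k + s) / 2 - k) lam
        - coronaVector V₂ u ((lam + k - s) / 2 - k) lam) := by
  funext ⟨x, o⟩
  rcases o with _ | y
  · simp only [coronaVector, Option.elim, Pi.smul_apply, Pi.sub_apply, smul_eq_mul]
    field_simp
    ring
  · simp [coronaVector]

variable [Fintype V₁] [DecidableEq V₁] [Fintype V₂]
  (G₁ : SimpleGraph V₁) [DecidableRel G₁.Adj] (G₂ : SimpleGraph V₂) [DecidableRel G₂.Adj]

theorem neighborhoodCorona_adjMatrix_mulVec_coronaVector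
    [DecidableRel (G₁.neighborhoodCorona G₂).Adj]
    {k : ℕ} (hreg : G₂.IsRegularOfDegree k) {u : V₁ → ℂ} {lam a b μ : ℂ}
    (hu : (G₁.adjMatrix ℂ).mulVec u = lam • u)
    (ha : lam * a + Fintype.card V₂ * lam * b = μ * a) (hb : lam * a + k * b = μ * b) :
    ((G₁.neighborhoodCorona G₂).adjMatrix ℂ).mulVec (coronaVector V₂ u a b)
      = μ • coronaVector V₂ u a b := by
  have hu' : ∀ x, (∑ x', if G₁.Adj x x' then u x' else 0) = lam * u x := by
    intro x
    simpa [Matrix.mulVec, dotProduct, adjMatrix_apply] using congrFun hu x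
  have hscale : ∀ (x : V₁) (c : ℂ),
      (∑ x', if G₁.Adj x x' then u x' * c else 0) = lam * u x * c := by
    intro x c
    rw [← hu', Finset.sum_mul]
    exact Finset.sum_congr rfl fun x' _ => by split_ifs <;> simp
  have hdeg : ∀ (y : V₂) (c : ℂ), (∑ y', if G₂.Adj y y' then c else 0) = k * c := by
    intro y c
    rw [← Finset.sum_filter, Finset.sum_const, nsmul_eq_mul, ← hreg.degree_eq y,
      ← card_neighborFinset_eq_degree, neighborFinset_eq_filter]
  funext ⟨x, o⟩
  simp only [Matrix.mulVec, dotProduct, adjMatrix_apply, ite_mul, one_mul, zero_mul,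
    Fintype.sum_prod_type, Fintype.sum_option, Pi.smul_apply, smul_eq_mul, coronaVector,
    Option.elim]
  rw [Finset.sum_add_distrib]
  rcases o with _ | y
  · have h1 : ∀ x', (G₁.neighborhoodCorona G₂).Adj (x, none) (x', none) ↔ G₁.Adj x x' :=
      fun _ => Iff.rfl
    have h2 : ∀ x' y', (G₁.neighborhoodCorona G₂).Adj (x, none) (x', some y') ↔ G₁.Adj x x' :=
      fun _ _ => Iff.rfl
    simp only [h1, h2]
    rw [Finset.sum_comm (s := univ) (t := univ) (f := fun x' (_ : V₂) => _)]
    simp only [hscale, Finset.sum_const, card_univ, nsmul_eq_mul]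
    linear_combination u x * ha
  · have h1 : ∀ x', (G₁.neighborhoodCorona G₂).Adj (x, some y) (x', none) ↔ G₁.Adj x x' :=
      fun _ => Iff.rfl
    have h2 : ∀ x' y', (G₁.neighborhoodCorona G₂).Adj (x, some y) (x', some y') ↔
        x = x' ∧ G₂.Adj y y' := fun _ _ => Iff.rfl
    simp only [h1, h2, ite_and]
    have h3 : ∀ x', (∑ y', if x = x' then if G₂.Adj y y' then u x' * b else 0 else 0)
        = if x = x' then k * (u x' * b) else 0 := by
      intro x'
      split_ifs
      · exact hdeg y _
      · simp
    simp only [hscale, h3, Finset.sum_ite_eq, mem_univ, if_true]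
    linear_combination u x * hb

end Corona

end SimpleGraph

namespace SimpleGraph

/-! ### Evolution of the lifted eigenvectors -/

section TransitionMatrix

variable {V₁ V₂ : Type*} [Fintype V₁] [DecidableEq V₁] [Fintype V₂]

theorem transitionMatrix_mulVec_eq_smul {W : Type*} [Fintype W] [DecidableEq W]
    (G : SimpleGraph W) [DecidableRel G.Adj] {v : W → ℂ} {μ : ℂ}
    (h : (G.adjMatrix ℂ).mulVec v = μ • v) (t : ℝ) :
    (G.transitionMatrix t).mulVec v = Complex.exp (-(Complex.I * t) * μ) • v := by
  classical
  rw [transitionMatrix]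
  convert Matrix.exp_smul_mulVec_of_mulVec_eq_smul (G.adjMatrix ℂ) v μ (-(Complex.I * t)) h

theorem transitionMatrix_neighborhoodCorona_mulVec_of_ker
    (G₁ : SimpleGraph V₁) [DecidableRel G₁.Adj] (G₂ : SimpleGraph V₂) [DecidableRel G₂.Adj]
    {k : ℕ} (hreg : G₂.IsRegularOfDegree k) {u : V₁ → ℂ}
    (hu : (G₁.adjMatrix ℂ).mulVec u = (0 : ℂ) • u) (t : ℝ) :
    ((G₁.neighborhoodCorona G₂).transitionMatrix t).mulVec (coronaVector V₂ u 1 0)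
      = coronaVector V₂ u 1 0 := by
  classical
  have h := neighborhoodCorona_adjMatrix_mulVec_coronaVector G₁ G₂ hreg
    (a := 1) (b := 0) (μ := 0) hu (by simp) (by simp)
  rw [transitionMatrix_mulVec_eq_smul _ h]
  simp

theorem norm_transitionMatrix_neighborhoodCorona_mulVec_add_le
    (G₁ : SimpleGraph V₁) [DecidableRel G₁.Adj] (G₂ : SimpleGraph V₂) [DecidableRel G₂.Adj]
    {k : ℕ} (hreg : G₂.IsRegularOfDegree k) {u : V₁ → ℂ} {lam s : ℂ} (hs : s ≠ 0)
    (hs2 : s ^ 2 = (lam - k) ^ 2 + 4 * Fintype.card V₂ * lam ^ 2)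
    (hu : (G₁.adjMatrix ℂ).mulVec u = lam • u) (t : ℝ) {δ : ℝ}
    (hplus : ‖Complex.exp (-(Complex.I * t) * ((lam + k + s) / 2)) + 1‖ ≤ δ)
    (hminus : ‖Complex.exp (-(Complex.I * t) * ((lam + k - s) / 2)) + 1‖ ≤ δ) (x : V₁) :
    ‖((G₁.neighborhoodCorona G₂).transitionMatrix t).mulVec (coronaVector V₂ u 1 0) (x, none)
      + u x‖ ≤ ‖u x‖ * (‖s⁻¹‖ *
        (‖(lam + k + s) / 2 - k‖ * δ + ‖(lam + k - s) / 2 - k‖ * δ)) := by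
  classical
  have h1 := neighborhoodCorona_adjMatrix_mulVec_coronaVector G₁ G₂ hreg
    (a := (lam + k + s) / 2 - k) (b := lam) (μ := (lam + k + s) / 2) hu
    -- With `b = lam`, `a = μ - k` solves the second equation; the first is then the quadratic for
    -- `μ`.
    (by linear_combination (-1 / 4) * hs2) (by ring)
  have h2 := neighborhoodCorona_adjMatrix_mulVec_coronaVector G₁ G₂ hreg
    (a := (lam + k - s) / 2 - k) (b := lam) (μ := (lam + k - s) / 2) hu
    (by linear_combination (-1 / 4) * hs2) (by ring)
  rw [coronaVector_one_zero hs u k lam, Matrix.mulVec_smul, Matrix.mulVec_sub,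
    transitionMatrix_mulVec_eq_smul _ h1, transitionMatrix_mulVec_eq_smul _ h2]
  simp only [Pi.smul_apply, Pi.sub_apply, smul_eq_mul, coronaVector, Option.elim]
  set p := Complex.exp (-(Complex.I * t) * ((lam + k + s) / 2))
  set q := Complex.exp (-(Complex.I * t) * ((lam + k - s) / 2))
  have key : s⁻¹ * (p * (u x * ((lam + k + s) / 2 - k)) - q * (u x * ((lam + k - s) / 2 - k)))
      + u x = u x * (s⁻¹ * (((lam + k + s) / 2 - k) * (p + 1)
        - ((lam + k - s) / 2 - k) * (q + 1))) := by
    field_simp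
    ring
  rw [key, norm_mul, norm_mul]
  gcongr
  refine (norm_sub_le _ _).trans ?_
  rw [norm_mul, norm_mul]
  gcongr

end TransitionMatrix

/-! ### The four-cycle and the choice of time -/

theorem cycleGraph_four_adjMatrix_mulVec (u : Fin 4 → ℂ) (x : Fin 4) :
    ((cycleGraph 4).adjMatrix ℂ).mulVec u x = u (x + 1) + u (x + 3) := by
  have h : ∀ x y : Fin 4, (cycleGraph 4).Adj x y ↔ y = x + 1 ∨ y = x + 3 := by decide
  simp only [Matrix.mulVec, dotProduct, adjMatrix_apply, h, Fin.sum_univ_four]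
  fin_cases x <;> simp [add_comm]

theorem cycleGraph_four_eq_add_two_of_dist_eq_two {v w : Fin 4}
    (h : (cycleGraph 4).dist v w = 2) : w = v + 2 := by
  have h1 : v ≠ w := by rintro rfl; simp at h
  have h2 : ¬ (cycleGraph 4).Adj v w := by
    intro hadj
    rw [dist_eq_one_iff_adj.2 hadj] at h
    omega
  clear h
  revert v w
  decide

end SimpleGraph

theorem Complex.exp_neg_I_mul_odd_eq_neg_one (l : ℕ) (q : ℤ) :
    Complex.exp (-(Complex.I * ((Real.pi * (4 * l + 1) : ℝ) : ℂ)) * (2 * q + 1)) = -1 := by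
  rw [← Complex.exp_pi_mul_I, Complex.exp_eq_exp_iff_exists_int]
  refine ⟨-(4 * l * q + 2 * l + q + 1), ?_⟩
  push_cast
  ring

theorem norm_exp_add_one_le_of_norm_exp_sub_one {l : ℕ} {q : ℤ} {s δ : ℝ}
    (h : ‖Complex.exp (Complex.I * ((Real.pi / 2 * (4 * l + 1) : ℝ) : ℂ) * ((-s : ℝ) : ℂ)) - 1‖ < δ) :
    ‖Complex.exp (-(Complex.I * ((Real.pi * (4 * l + 1) : ℝ) : ℂ)) * ((2 * q + 1) + s / 2)) + 1‖
      ≤ δ := by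
  rw [mul_add, Complex.exp_add, Complex.exp_neg_I_mul_odd_eq_neg_one]
  have : -(Complex.I * ((Real.pi * (4 * l + 1) : ℝ) : ℂ)) * ((s : ℂ) / 2)
      = Complex.I * ((Real.pi / 2 * (4 * l + 1) : ℝ) : ℂ) * ((-s : ℝ) : ℂ) := by
    push_cast; ring
  rw [this, ← norm_neg]
  refine le_trans (le_of_eq ?_) h.le
  congr 1
  ring

theorem irrational_sqrt_of_forall_ne_int {a : ℤ} (h : ¬ ∃ m : ℤ, √(a : ℝ) = m) (ha : 0 ≤ a) :
    Irrational √(a : ℝ) := by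
  refine irrational_nrt_of_notint_nrt 2 a ?_ (by simpa [eq_comm] using h) (by norm_num)
  rw [Real.sq_sqrt (by exact_mod_cast ha)]

/-- Some time `π * (4 * l + 1)` makes the phases belonging to the eigenvalues
`(2 * q + 1) ± s / 2` and `(2 * q' + 1) ± s' / 2` close to `-1`. -/
theorem exists_norm_exp_add_one_le {s s' : ℝ} (hs : Irrational s) (hs' : Irrational s')
    {A B : ℤ} (hA : s ^ 2 = A) (hB : s' ^ 2 = B) (q q' : ℤ) {δ : ℝ} (hδ : 0 < δ) :
    ∃ t : ℝ, 0 < t ∧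
      ‖Complex.exp (-(Complex.I * t) * ((2 * q + 1) + s / 2)) + 1‖ ≤ δ ∧
      ‖Complex.exp (-(Complex.I * t) * ((2 * q + 1) - s / 2)) + 1‖ ≤ δ ∧
      ‖Complex.exp (-(Complex.I * t) * ((2 * q' + 1) + s' / 2)) + 1‖ ≤ δ ∧
      ‖Complex.exp (-(Complex.I * t) * ((2 * q' + 1) - s' / 2)) + 1‖ ≤ δ := by
  -- Listing both signs covers both eigenvalues of each pair directly.
  obtain ⟨l, hl⟩ := exists_norm_exp_sub_one_lt ![-s, s, -s', s'] (fun c => by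
    have h := combination_eq_zero_or_irrational hs hs' hA hB (c 1 - c 0) (c 3 - c 2)
    have he : ∑ j, (c j : ℝ) * ![-s, s, -s', s'] j
        = ((c 1 - c 0 : ℤ) : ℝ) * s + ((c 3 - c 2 : ℤ) : ℝ) * s' := by
      simp [Fin.sum_univ_four]
      ring
    rwa [he]) hδ
  have h0 := norm_exp_add_one_le_of_norm_exp_sub_one (q := q) (s := s) (hl 0)
  have h1 := norm_exp_add_one_le_of_norm_exp_sub_one (q := q) (s := -s)
    (by rw [neg_neg]; exact hl 1)
  have h2 := norm_exp_add_one_le_of_norm_exp_sub_one (q := q') (s := s') (hl 2)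
  have h3 := norm_exp_add_one_le_of_norm_exp_sub_one (q := q') (s := -s')
    (by rw [neg_neg]; exact hl 3)
  rw [Complex.ofReal_neg, neg_div, ← sub_eq_add_neg] at h1 h3
  exact ⟨Real.pi * (4 * l + 1), by positivity, h0, h1, h2, h3⟩

end

theorem theorem5p3 {V : Type*} [Fintype V] (G₂ : SimpleGraph V) [DecidableRel G₂.Adj]
    (k n₂ : ℕ) (hcard : Fintype.card V = n₂)
    (hconn : G₂.Connected) (hreg : G₂.IsRegularOfDegree k) (hk : k ≡ 0 [MOD 4])
    (hplus : ¬ ∃ m : ℤ, Real.sqrt ((2 + (k : ℝ)) ^ 2 + 16 * (n₂ : ℝ)) = (m : ℝ))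
    (hminus : ¬ ∃ m : ℤ, Real.sqrt ((2 - (k : ℝ)) ^ 2 + 16 * (n₂ : ℝ)) = (m : ℝ))
    (v₁ v₃ : Fin 4) (hanti : (SimpleGraph.cycleGraph 4).dist v₁ v₃ = 2) :
    ((SimpleGraph.cycleGraph 4).neighborhoodCorona G₂).PrettyGoodStateTransfer
      (v₁, none) (v₃, none) := by
  classical
  obtain ⟨q, rfl⟩ := (Nat.modEq_zero_iff_dvd).1 hk
  obtain rfl := SimpleGraph.cycleGraph_four_eq_add_two_of_dist_eq_two hanti
  have eA : (2 - ((4 * q : ℕ) : ℝ)) ^ 2 + 16 * (n₂ : ℝ)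
      = (((2 - (4 * q : ℕ)) ^ 2 + 16 * n₂ : ℤ) : ℝ) := by push_cast; ring
  have eB : (2 + ((4 * q : ℕ) : ℝ)) ^ 2 + 16 * (n₂ : ℝ)
      = (((2 + (4 * q : ℕ)) ^ 2 + 16 * n₂ : ℤ) : ℝ) := by push_cast; ring
  rw [eA] at hminus
  rw [eB] at hplus
  have hsirr := irrational_sqrt_of_forall_ne_int hminus (by positivity)
  have hs'irr := irrational_sqrt_of_forall_ne_int hplus (by positivity)
  have hs2 := Real.sq_sqrt (x := (((2 - (4 * q : ℕ)) ^ 2 + 16 * n₂ : ℤ) : ℝ))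
    (by rw [← eA]; positivity)
  have hs'2 := Real.sq_sqrt (x := (((2 + (4 * q : ℕ)) ^ 2 + 16 * n₂ : ℤ) : ℝ))
    (by rw [← eB]; positivity)
  set s : ℝ := √(((2 - (4 * q : ℕ)) ^ 2 + 16 * n₂ : ℤ) : ℝ)
  set s' : ℝ := √(((2 + (4 * q : ℕ)) ^ 2 + 16 * n₂ : ℤ) : ℝ)
  have hs0 : (s : ℂ) ≠ 0 := by exact_mod_cast hsirr.ne_zero
  have hs'0 : (s' : ℂ) ≠ 0 := by exact_mod_cast hs'irr.ne_zero
  intro ε hε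
  set C : ℝ := ‖(s : ℂ)⁻¹‖ * (‖((2 : ℂ) + (4 * q : ℕ) + s) / 2 - (4 * q : ℕ)‖
    + ‖((2 : ℂ) + (4 * q : ℕ) - s) / 2 - (4 * q : ℕ)‖) with hC
  set C' : ℝ := ‖(s' : ℂ)⁻¹‖ * (‖((-2 : ℂ) + (4 * q : ℕ) + s') / 2 - (4 * q : ℕ)‖
    + ‖((-2 : ℂ) + (4 * q : ℕ) - s') / 2 - (4 * q : ℕ)‖) with hC'
  have hC0 : 0 ≤ C := by positivity
  have hC'0 : 0 ≤ C' := by positivity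
  set δ : ℝ := ε / (C + C' + 1) with hδ
  have hδ0 : 0 < δ := by positivity
  obtain ⟨t, ht, h1, h2, h3, h4⟩ :=
    -- The half-sums are `(2 + 4q) / 2 = 2q + 1` and `(-2 + 4q) / 2 = 2(q - 1) + 1`.
    exists_norm_exp_add_one_le hsirr hs'irr hs2 hs'2 q (q - 1) hδ0
  refine ⟨t, ht, ?_⟩
  -- The delta at `v₁` is `1/4 + σ/4 + ρ/2`, with eigenvalues 2, -2, 0; only `ρ` changes sign
  -- between the antipodes.
  let σ : Fin 4 → ℂ := fun x => if x = v₁ ∨ x = v₁ + 2 then 1 else -1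
  let ρ : Fin 4 → ℂ := fun x => if x = v₁ then 1 else if x = v₁ + 2 then -1 else 0
  have hone : ((SimpleGraph.cycleGraph 4).adjMatrix ℂ).mulVec (fun _ => 1)
      = (2 : ℂ) • fun _ => (1 : ℂ) := by
    funext x
    rw [SimpleGraph.cycleGraph_four_adjMatrix_mulVec]
    norm_num
  have hσ : ((SimpleGraph.cycleGraph 4).adjMatrix ℂ).mulVec σ = (-2 : ℂ) • σ := by
    funext x
    rw [SimpleGraph.cycleGraph_four_adjMatrix_mulVec]
    have e1 : ∀ v x : Fin 4, x + 1 = v ∨ x + 1 = v + 2 ↔ ¬ (x = v ∨ x = v + 2) := by decide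
    have e3 : ∀ v x : Fin 4, x + 3 = v ∨ x + 3 = v + 2 ↔ ¬ (x = v ∨ x = v + 2) := by decide
    simp only [σ, e1, e3, Pi.smul_apply, smul_eq_mul]
    by_cases h : x = v₁ ∨ x = v₁ + 2
    · simp only [h, not_true_eq_false, if_true, if_false]; norm_num
    · simp only [h, not_false_eq_true, if_true, if_false]; norm_num
  have hρ : ((SimpleGraph.cycleGraph 4).adjMatrix ℂ).mulVec ρ = (0 : ℂ) • ρ := by
    funext x
    rw [SimpleGraph.cycleGraph_four_adjMatrix_mulVec]
    have e1 : ∀ v x : Fin 4, x + 3 = v + 2 ↔ x + 1 = v := by decide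
    have e3 : ∀ v x : Fin 4, x + 3 = v ↔ x + 1 = v + 2 := by decide
    simp only [ρ, e1, e3, zero_smul, Pi.zero_apply]
    by_cases h : x + 1 = v₁
    · simp [h]
    · by_cases h' : x + 1 = v₁ + 2 <;> simp [h, h']
  have b1 := SimpleGraph.norm_transitionMatrix_neighborhoodCorona_mulVec_add_le
    (SimpleGraph.cycleGraph 4) G₂ hreg hs0 (lam := 2)
    (by
      rw [hcard]
      have : (s : ℂ) ^ 2 = ((s ^ 2 : ℝ) : ℂ) := by push_cast; rfl
      rw [this, hs2]; push_cast; ring) hone t (δ := δ)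
    (by convert h1 using 5; push_cast; ring) (by convert h2 using 5; push_cast; ring) (v₁ + 2)
  have b2 := SimpleGraph.norm_transitionMatrix_neighborhoodCorona_mulVec_add_le
    (SimpleGraph.cycleGraph 4) G₂ hreg hs'0 (lam := -2)
    (by
      rw [hcard]
      have : (s' : ℂ) ^ 2 = ((s' ^ 2 : ℝ) : ℂ) := by push_cast; rfl
      rw [this, hs'2]; push_cast; ring) hσ t (δ := δ)
    (by convert h3 using 5; push_cast; ring) (by convert h4 using 5; push_cast; ring) (v₁ + 2)
  have b3 := congrFun (SimpleGraph.transitionMatrix_neighborhoodCorona_mulVec_of_ker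
    (SimpleGraph.cycleGraph 4) G₂ hreg hρ t) (v₁ + 2, none)
  have hv : v₁ + 2 ≠ v₁ := by clear * -; revert v₁; decide
  have hσv : σ (v₁ + 2) = 1 := by simp [σ]
  have hρv : ρ (v₁ + 2) = -1 := by simp [ρ]
  replace b1 := b1.trans_eq (c := C * δ) (by rw [hC, norm_one]; ring)
  rw [hσv] at b2
  replace b2 := b2.trans_eq (c := C' * δ) (by rw [hC', norm_one]; ring)
  have b3' : SimpleGraph.coronaVector V ρ 1 0 (v₁ + 2, none) = -1 := by
    simp [SimpleGraph.coronaVector, hρv]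
  rw [b3'] at b3
  set U := ((SimpleGraph.cycleGraph 4).neighborhoodCorona G₂).transitionMatrix t with hU
  have hdec : (Pi.single (v₁, none) 1 : Fin 4 × Option V → ℂ)
      = (1 / 4 : ℂ) • SimpleGraph.coronaVector V (fun _ => 1) 1 0
        + (1 / 4 : ℂ) • SimpleGraph.coronaVector V σ 1 0
        + (1 / 2 : ℂ) • SimpleGraph.coronaVector V ρ 1 0 := by
    funext ⟨x, o⟩
    rcases o with _ | y
    · simp only [Pi.single_apply, Prod.mk.injEq, and_true, SimpleGraph.coronaVector, Option.elim,
        Pi.add_apply, Pi.smul_apply, smul_eq_mul, σ, ρ]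
      by_cases h : x = v₁
      · simp only [h, true_or, if_true]; norm_num
      · by_cases h' : x = v₁ + 2
        · simp only [h', hv, or_true, if_true, if_false]; norm_num
        · simp only [h, h', or_self, if_false]; norm_num
    · simp [SimpleGraph.coronaVector]
  have hamp : U (v₁ + 2, none) (v₁, none) = (U.mulVec (Pi.single (v₁, none) 1)) (v₁ + 2, none) := by
    simp
  rw [hdec, Matrix.mulVec_add, Matrix.mulVec_add, Matrix.mulVec_smul, Matrix.mulVec_smul,
    Matrix.mulVec_smul] at hamp
  simp only [Pi.add_apply, Pi.smul_apply, smul_eq_mul, b3] at hamp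
  set x := U.mulVec (SimpleGraph.coronaVector V (fun _ => 1) 1 0) (v₁ + 2, none)
  set y := U.mulVec (SimpleGraph.coronaVector V σ 1 0) (v₁ + 2, none)
  have hclose : ‖U (v₁ + 2, none) (v₁, none) + 1‖ ≤ 1 / 4 * (C * δ) + 1 / 4 * (C' * δ) := by
    rw [hamp, show 1 / 4 * x + 1 / 4 * y + 1 / 2 * -1 + 1 = 1 / 4 * (x + 1) + 1 / 4 * (y + 1) by
      ring]
    refine (norm_add_le _ _).trans ?_
    rw [norm_mul, norm_mul, show ‖(1 / 4 : ℂ)‖ = 1 / 4 by norm_num]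
    gcongr
  have hδε : (C + C' + 1) * δ = ε := by rw [hδ]; field_simp
  have htri : 1 ≤ ‖U (v₁ + 2, none) (v₁, none) + 1‖ + ‖U (v₁ + 2, none) (v₁, none)‖ := by
    simpa using norm_sub_le (U (v₁ + 2, none) (v₁, none) + 1) (U (v₁ + 2, none) (v₁, none))
  have hCδ := mul_nonneg hC0 hδ0.le
  have hC'δ := mul_nonneg hC'0 hδ0.le
  linarith
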